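/- Let $\mathbb K$ be a field, $S=\mathbb K[x_1,\dots,x_n]$, and let $J\subsetneq I\subseteq S$ be monomial ideals. Then $$\operatorname{sdepth}(I/J)\ \ge\ n-\dim L_{I/J}\qquad\text{and}\qquad \operatorname{sdepth}(I)\ \ge\ n-\dim L_I+1 .$$ Here the following notation is used. For a nonzero finitely generated $\mathbb Z^n$-graded $S$-module $M$, a Stanley space of dimension $|Z|$ is a $\mathbb K$-subspace $u\mathbb K[Z]=\{uv : v\in\mathbb K[Z]\}$, where $u\in M$ is a nonzero homogeneous element and $Z\subseteq\{x_1,\dots,x_n\}$ are such that $u\mathbb K[Z]$ is a free $\mathbb K[Z]$-module. A Stanley decomposition of $M$ is a decomposition of $M$, as a $\mathbb K$-vector space, into a finite direct sum of Stanley spaces; its Stanley depth is the minimum of the dimensions of these spaces, and $\operatorname{sdepth}(M)$ is the maximum of the Stanley depths of all Stanley decompositions of $M$. For a monomial ideal $I$, let $G(I)$ be its set of minimal monomial generators. The lcm lattice $L_{I/J}$ is the set of all least common multiples of nonempty subsets of $G(I)\cup G(J)$, ordered by divisibility, together with an additional minimal element $\hat 0$ (added also when $1\in G(I)$), and $L_I:=L_{I/0}$.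 The order dimension $\dim P$ of a finite poset $P$ is the least $d\in\mathbb N$ for which there is a map $j:P\to\mathbb N^d$ such that $p\le q\iff j(p)\le j(q)$ for all $p,q\in P$, where $\mathbb N^d$ is ordered componentwise. -/

import Mathlib

noncomputable section

namespace StanleyDim

/-! ### Stanley depth of multigraded modules -/

section StanleyDepth

variable {K : Type*} [Field K] {n : ℕ} {M : Type*} [AddCommGroup M]
  [Module (MvPolynomial (Fin n) K) M] [Module K M] [IsScalarTower K (MvPolynomial (Fin n) K) M]

/-- The `K`-subspace `u K[Z]` of an `S`-module `M`, where `S = K[x_1, …, x_n]`, `u ∈ M` and `Z` is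
a set of variables: it consists of the elements `v • u` with `v ∈ K[Z]`. -/
def stanleySpace (u : M) (Z : Finset (Fin n)) : Submodule K M :=
  (Subalgebra.toSubmodule (MvPolynomial.supported K (Z : Set (Fin n)))).map
    ((LinearMap.toSpanSingleton (MvPolynomial (Fin n) K) M u).restrictScalars K)

/-- A Stanley decomposition of the module `M` whose homogeneous component of degree `a ∈ ℤⁿ` is
`gr a`: a finite family of Stanley spaces `u_i K[Z_i]`, with `u_i` homogeneous and with
`u_i K[Z_i]` free over `K[Z_i]` on the generator `u_i`, of which `M` is the direct sum. -/
structure StanleyDecomposition (gr : (Fin n → ℤ) → Submodule K M) where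
  /-- the number of summands -/
  size : ℕ
  /-- the generators of the summands -/
  u : Fin size → M
  /-- the sets of variables of the summands -/
  Z : Fin size → Finset (Fin n)
  homogeneous : ∀ i, ∃ a, u i ∈ gr a
  free : ∀ i, ∀ v ∈ MvPolynomial.supported K (Z i : Set (Fin n)), v • u i = 0 → v = 0
  isInternal : DirectSum.IsInternal (fun i => stanleySpace (K := K) (u i) (Z i))

/-- The Stanley depth of a Stanley decomposition: the minimum of the dimensions `|Z_i|` of its
Stanley spaces (there is at least one of them if `M` is nonzero). -/
def StanleyDecomposition.sdepth {gr : (Fin n → ℤ) → Submodule K M}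
    (D : StanleyDecomposition gr) : ℕ :=
  sInf (Set.range fun i => (D.Z i).card)

/-- The Stanley depth of the module `M` with homogeneous components `gr a`: the maximum of the
Stanley depths of its Stanley decompositions (all of these are at most `n`). -/
def sdepth (gr : (Fin n → ℤ) → Submodule K M) : ℕ :=
  sSup (Set.range fun D : StanleyDecomposition gr => D.sdepth)

end StanleyDepth

/-! ### Monomial ideals and their quotients -/

section MonomialIdeals

variable {K : Type*} [Field K] {n : ℕ}

/-- A monomial ideal is an ideal generated by a set of monomials. -/
def IsMonomialIdeal (I : Ideal (MvPolynomial (Fin n) K)) : Prop :=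
  ∃ A : Set (Fin n →₀ ℕ), I = Ideal.span ((fun a => MvPolynomial.monomial a (1 : K)) '' A)

/-- The homogeneous component of degree `a ∈ ℤⁿ` of an ideal `I`: the elements of `I` of the form
`c x^a` (only `0` if `a` has a negative entry). -/
def idealComponent (I : Ideal (MvPolynomial (Fin n) K)) (a : Fin n → ℤ) : Submodule K I where
  carrier := {f | ∀ b ∈ (f : MvPolynomial (Fin n) K).support, (fun i => (b i : ℤ)) = a}
  zero_mem' := by simp
  add_mem' := by
    classical
    intro f g hf hg b hb
    rcases Finset.mem_union.1 (MvPolynomial.support_add hb) with h | h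
    · exact hf b h
    · exact hg b h
  smul_mem' := by
    intro c f hf b hb
    exact hf b (MvPolynomial.support_smul hb)

/-- The module `I / J`, for ideals `J ⊆ I` of the polynomial ring. -/
abbrev QuotientModule (I J : Ideal (MvPolynomial (Fin n) K)) : Type _ :=
  I ⧸ Submodule.submoduleOf J I

/-- The homogeneous component of degree `a ∈ ℤⁿ` of `I / J`: the image of that of `I`. -/
def quotientComponent (I J : Ideal (MvPolynomial (Fin n) K)) (a : Fin n → ℤ) :
    Submodule K (QuotientModule I J) :=
  (idealComponent I a).map ((Submodule.mkQ (Submodule.submoduleOf J I)).restrictScalars K)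

/-- The Stanley depth of a monomial ideal `I`, as a multigraded module. -/
def sdepthIdeal (I : Ideal (MvPolynomial (Fin n) K)) : ℕ :=
  sdepth (idealComponent I)

/-- The Stanley depth of `I / J`, for monomial ideals `J ⊊ I`. -/
def sdepthQuotient (I J : Ideal (MvPolynomial (Fin n) K)) : ℕ :=
  sdepth (quotientComponent I J)

/-! ### The lcm lattice and the order dimension

A monomial `x^a` is represented by its exponent vector `a`, so that divisibility is `≤` and the
least common multiple is the supremum. -/

/-- The minimal monomial generators `G(I)` of a monomial ideal: the monomials of `I` that are
minimal with respect to divisibility. -/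
def minGens (I : Ideal (MvPolynomial (Fin n) K)) : Set (Fin n →₀ ℕ) :=
  {a | Minimal (fun b => MvPolynomial.monomial b (1 : K) ∈ I) a}

/-- The least common multiples of the nonempty subsets of `G(I) ∪ G(J)`. -/
def lcmSet (I J : Ideal (MvPolynomial (Fin n) K)) : Set (Fin n →₀ ℕ) :=
  {m | ∃ T : Finset (Fin n →₀ ℕ), T.Nonempty ∧ (T : Set (Fin n →₀ ℕ)) ⊆ minGens I ∪ minGens J ∧
    m = T.sup id}

/-- The lcm lattice `L_{I/J}`: the set `lcmSet I J`, ordered by divisibility, with an additional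
minimal element (one that differs from the monomial `1` also if `1` lies in `lcmSet I J`). -/
abbrev LcmLattice (I J : Ideal (MvPolynomial (Fin n) K)) : Type :=
  WithBot (lcmSet I J)

end MonomialIdeals

/-- The order dimension of a finite poset `P`: the least `d` such that there is a map
`j : P → ℕ^d`, with `p ≤ q` if and only if `j p ≤ j q`. -/
def orderDim (P : Type*) [PartialOrder P] : ℕ :=
  sInf {d | Nonempty (P ↪o (Fin d → ℕ))}

end StanleyDim

end

/-!
Let `G = G(I) ∪ G(J)` and let `j` be an order embedding of the lcm lattice into `ℕ^d`. For each
coordinate `k` and each `t`, let `γ_k(t)` be the greatest common divisor of the generators `h ∈ G`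
with `j(h)_k ≥ t`. The point is that for `g ∈ G` and an arbitrary exponent vector `a`

  `g ≤ a` if and only if `γ_k(j(g)_k) ≤ a` for all `k`.

Indeed, if `g i > a i` for some `i`, let `r` be the lcm of all `h ∈ G` with `h i ≤ a i` (or the
bottom element if there are none). Then `g ≰ r`, so `j(g)_k > j(r)_k` for some `k`, and hence every
`h ∈ G` with `j(h)_k ≥ j(g)_k` satisfies `h i > a i`, so that `γ_k(j(g)_k) ≰ a`. This is
`exists_isSeparating` together with `IsSeparating.exists_levels`, which defines the level `l a k`
as the largest `t` with `γ_k(t) ≤ a` and restates the equivalence as `g ≤ a ↔ j g ≤ l a`.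

Thus membership of `x^a` in `I` and in `J` depends only on the level vector of `a`, which takes
finitely many values. Fixing the levels in a set `s` of coordinates describes a principal filter
from which at most `|s|` principal filters are removed. Such a set is a finite disjoint union of
boxes `u + ℕ^Z` with `|Z| ≥ n - |s|` (`hasBoxPartition_of_isPrincipalFilter`). For `I / J` all `d`
levels are fixed (`IsSeparating.hasBoxPartition_diff`). For `I` itself one level can be left
free: with the others fixed, membership in `I` is a lower bound on the remaining level, which is
again a principal filter, so that only `d - 1` directions are lost
(`IsSeparating.hasBoxPartition_filter`). Finally a partition of the monomials of `I` outside of `J`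
into boxes is a Stanley decomposition of `I / J` (`exists_stanleyDecomposition`).
-/

namespace StanleyDim

/-! ### Partitions of sets of exponent vectors into boxes -/

section Combinatorics

variable {n e : ℕ}

/-- The exponent vectors of the monomials in the Stanley space `x^u K[Z]`: a box that is unbounded
in the directions of `Z` and one point wide in all others. -/
def stanleyBox (u : Fin n →₀ ℕ) (Z : Finset (Fin n)) : Set (Fin n →₀ ℕ) :=
  {a | u ≤ a ∧ ∀ i ∉ Z, a i = u i}

theorem self_mem_stanleyBox (u : Fin n →₀ ℕ) (Z : Finset (Fin n)) : u ∈ stanleyBox u Z :=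
  ⟨le_rfl, fun _ _ => rfl⟩

/-- `HasBoxPartition e A` says that `A` is a finite disjoint union of boxes `stanleyBox u Z` with
at most `e` directions missing from each `Z`. -/
inductive HasBoxPartition (e : ℕ) : Set (Fin n →₀ ℕ) → Prop
  | empty : HasBoxPartition e ∅
  | box (u : Fin n →₀ ℕ) (Z : Finset (Fin n)) (h : n ≤ Z.card + e) :
      HasBoxPartition e (stanleyBox u Z)
  | union {A B : Set (Fin n →₀ ℕ)} (hA : HasBoxPartition e A) (hB : HasBoxPartition e B)
      (hAB : Disjoint A B) : HasBoxPartition e (A ∪ B)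

theorem HasBoxPartition.exists_family {A : Set (Fin n →₀ ℕ)} (h : HasBoxPartition e A) :
    ∃ (m : ℕ) (u : Fin m → Fin n →₀ ℕ) (Z : Fin m → Finset (Fin n)),
      (∀ i, n ≤ (Z i).card + e) ∧ (∀ i, stanleyBox (u i) (Z i) ⊆ A) ∧
      (∀ a ∈ A, ∃ i, a ∈ stanleyBox (u i) (Z i)) ∧
      ∀ a i k, a ∈ stanleyBox (u i) (Z i) → a ∈ stanleyBox (u k) (Z k) → i = k := by
  suffices H : ∃ (ι : Type) (_ : Fintype ι) (u : ι → Fin n →₀ ℕ) (Z : ι → Finset (Fin n)),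
      (∀ i, n ≤ (Z i).card + e) ∧ (∀ i, stanleyBox (u i) (Z i) ⊆ A) ∧
      (∀ a ∈ A, ∃ i, a ∈ stanleyBox (u i) (Z i)) ∧
      ∀ a i k, a ∈ stanleyBox (u i) (Z i) → a ∈ stanleyBox (u k) (Z k) → i = k by
    obtain ⟨ι, _, u, Z, h1, h2, h3, h4⟩ := H
    let f := Fintype.equivFin ι
    refine ⟨Fintype.card ι, u ∘ f.symm, Z ∘ f.symm, fun i => h1 _, fun i => h2 _, fun a ha => ?_,
      fun a i k hi hk => f.symm.injective (h4 a _ _ hi hk)⟩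
    obtain ⟨i, hi⟩ := h3 a ha
    exact ⟨f i, by simpa using hi⟩
  induction h with
  | empty =>
    exact ⟨Empty, inferInstance, Empty.elim, Empty.elim, by simp, by simp, by simp, by simp⟩
  | box u Z h =>
    exact ⟨Unit, inferInstance, fun _ => u, fun _ => Z, fun _ => h, fun _ => subset_rfl,
      fun a ha => ⟨(), ha⟩, fun _ _ _ _ _ => rfl⟩
  | union _ _ hAB ihA ihB =>
    obtain ⟨ι, _, u, Z, h1, h2, h3, h4⟩ := ihA
    obtain ⟨κ, _, u', Z', h1', h2', h3', h4'⟩ := ihB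
    refine ⟨ι ⊕ κ, inferInstance, Sum.elim u u', Sum.elim Z Z', ?_, ?_, ?_, ?_⟩
    · rintro (i | i)
      exacts [h1 i, h1' i]
    · rintro (i | i)
      exacts [(h2 i).trans Set.subset_union_left, (h2' i).trans Set.subset_union_right]
    · rintro a (ha | ha)
      · obtain ⟨i, hi⟩ := h3 a ha
        exact ⟨Sum.inl i, hi⟩
      · obtain ⟨i, hi⟩ := h3' a ha
        exact ⟨Sum.inr i, hi⟩
    · rintro a (i | i) (k | k) hi hk
      · exact congrArg _ (h4 a i k hi hk)
      · exact (Set.disjoint_left.1 hAB (h2 i hi) (h2' k hk)).elim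
      · exact (Set.disjoint_left.1 hAB (h2 k hk) (h2' i hi)).elim
      · exact congrArg _ (h4' a i k hi hk)

/-- If the fibers of a map to a finite type cut `A` into sets with box partitions, then `A` has a
box partition. -/
theorem HasBoxPartition.of_fibers {ι : Type*} [Fintype ι] {A : Set (Fin n →₀ ℕ)}
    (f : (Fin n →₀ ℕ) → ι) (h : ∀ p, HasBoxPartition e {a | a ∈ A ∧ f a = p}) :
    HasBoxPartition e A := by
  classical
  suffices H : ∀ t : Finset ι, HasBoxPartition e {a | a ∈ A ∧ f a ∈ t} by
    simpa using H Finset.univ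
  intro t
  induction t using Finset.induction_on with
  | empty => simpa using HasBoxPartition.empty
  | insert p t hp ih =>
    have hd : Disjoint {a | a ∈ A ∧ f a = p} {a | a ∈ A ∧ f a ∈ t} := by
      rw [Set.disjoint_left]
      rintro a ⟨_, h1⟩ ⟨_, h2⟩
      exact hp (h1 ▸ h2)
    convert HasBoxPartition.union (h p) ih hd using 1
    ext a
    simp only [Finset.mem_insert, Set.mem_ofPred_eq, Set.mem_union]
    tauto

/-- Removing a principal filter from a box costs at most one free direction: a free direction `i`
with `u i < γ i` is used to split off the slice `a i = u i`, which misses the filter altogether,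
and the rest of the box is a box whose corner is closer to `γ`. -/
theorem hasBoxPartition_stanleyBox_diff_Ici (u : Fin n →₀ ℕ) (Z : Finset (Fin n))
    (γ : Fin n →₀ ℕ) (h : n ≤ Z.card + e) :
    HasBoxPartition (e + 1) (stanleyBox u Z \ Set.Ici γ) := by
  classical
  induction hN : ∑ i, (γ i - u i) using Nat.strong_induction_on generalizing u with
  | _ N ih =>
    by_cases hlt : ∃ i, u i < γ i
    · obtain ⟨i, hi⟩ := hlt
      by_cases hZ : i ∈ Z
      · have hslice : HasBoxPartition (e + 1) (stanleyBox u (Z.erase i)) :=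
          .box u _ (by rw [Finset.card_erase_of_mem hZ]; omega)
        have hrest : HasBoxPartition (e + 1)
            (stanleyBox (u + Finsupp.single i 1) Z \ Set.Ici γ) := by
          refine ih _ ?_ _ rfl
          rw [← hN]
          refine Finset.sum_lt_sum (fun k _ => ?_) ⟨i, Finset.mem_univ i, ?_⟩
          · simp only [Finsupp.add_apply]
            omega
          · simp only [Finsupp.add_apply, Finsupp.single_eq_same]
            omega
        convert hslice.union hrest ?_ using 1
        · ext a
          simp only [stanleyBox, Set.mem_sdiff, Set.mem_ofPred_eq, Set.mem_Ici, Set.mem_union,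
            Finset.mem_erase, not_and, Finsupp.le_def, Finsupp.add_apply, Finsupp.single_apply]
          constructor
          · rintro ⟨⟨h1, h2⟩, h3⟩
            by_cases hai : a i = u i
            · refine Or.inl ⟨h1, fun k hk => ?_⟩
              by_cases hki : k = i
              · rw [hki, hai]
              · exact h2 k (hk hki)
            · refine Or.inr ⟨⟨fun k => ?_, fun k hk => ?_⟩, h3⟩
              · have := h1 k
                split_ifs with hik
                · subst hik
                  omega
                · omega
              · rw [if_neg (fun hik : i = k => hk (hik ▸ hZ)), h2 k hk, add_zero]
          · rintro (⟨h1, h2⟩ | ⟨⟨h1, h2⟩, h3⟩)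
            · refine ⟨⟨h1, fun k hk => h2 k fun _ => hk⟩, fun h3 => ?_⟩
              have := h3 i
              have := h2 i (fun h => (h rfl).elim)
              omega
            · refine ⟨⟨fun k => le_trans (Nat.le_add_right _ _) (h1 k), fun k hk => ?_⟩, h3⟩
              rw [h2 k hk, if_neg (fun hik : i = k => hk (hik ▸ hZ)), add_zero]
        · rw [Set.disjoint_left]
          rintro a ⟨_, h1⟩ ⟨⟨h2, _⟩, _⟩
          have h1i := h1 i (Finset.notMem_erase i Z)
          have h2i := h2 i
          simp only [Finsupp.add_apply, Finsupp.single_eq_same] at h2i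
          omega
      · convert HasBoxPartition.box (e := e + 1) u Z (by omega) using 1
        rw [sdiff_eq_left, Set.disjoint_left]
        rintro a ⟨_, h2⟩ h3
        have := h2 i hZ
        have := (show γ ≤ a from h3) i
        omega
    · push Not at hlt
      convert HasBoxPartition.empty (n := n) (e := e + 1) using 1
      rw [Set.sdiff_eq_empty]
      rintro a ⟨h1, _⟩
      exact le_trans (show γ ≤ u from hlt) h1

theorem HasBoxPartition.diff_Ici {A : Set (Fin n →₀ ℕ)} (hA : HasBoxPartition e A)
    (γ : Fin n →₀ ℕ) : HasBoxPartition (e + 1) (A \ Set.Ici γ) := by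
  induction hA with
  | empty => simpa using HasBoxPartition.empty
  | box u Z h => exact hasBoxPartition_stanleyBox_diff_Ici u Z γ h
  | union _ _ hAB ihA ihB =>
    rw [Set.union_sdiff_distrib]
    exact ihA.union ihB (hAB.mono Set.sdiff_subset Set.sdiff_subset)

theorem HasBoxPartition.succ {A : Set (Fin n →₀ ℕ)} (hA : HasBoxPartition e A) :
    HasBoxPartition (e + 1) A := by
  induction hA with
  | empty => exact .empty
  | box u Z h => exact .box u Z (by omega)
  | union _ _ hAB ihA ihB => exact ihA.union ihB hAB

/-- A principal filter of exponent vectors, or the empty set: the exponent vectors of the monomials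
of a principal monomial ideal, the zero ideal being allowed. -/
def IsPrincipalFilter (U : Set (Fin n →₀ ℕ)) : Prop :=
  U = ∅ ∨ ∃ γ, U = Set.Ici γ

theorem isPrincipalFilter_univ : IsPrincipalFilter (Set.univ : Set (Fin n →₀ ℕ)) :=
  Or.inr ⟨0, by ext; simp⟩

theorem IsPrincipalFilter.inter {U V : Set (Fin n →₀ ℕ)} (hU : IsPrincipalFilter U)
    (hV : IsPrincipalFilter V) : IsPrincipalFilter (U ∩ V) := by
  rcases hU with rfl | ⟨γ, rfl⟩
  · exact Or.inl (Set.empty_inter V)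
  · rcases hV with rfl | ⟨δ, rfl⟩
    · exact Or.inl (Set.inter_empty _)
    · exact Or.inr ⟨γ ⊔ δ, Set.Ici_inter_Ici⟩

theorem IsPrincipalFilter.setOf_forall_mem {κ : Type*} (s : Finset κ)
    {U : κ → Set (Fin n →₀ ℕ)} (hU : ∀ k, IsPrincipalFilter (U k)) :
    IsPrincipalFilter {a | ∀ k ∈ s, a ∈ U k} := by
  classical
  induction s using Finset.induction_on with
  | empty => simpa using isPrincipalFilter_univ
  | insert k s _ ih =>
    convert (hU k).inter ih using 1
    ext a
    simp

/-- The monomials of a principal ideal that lie outside of `e` further principal ideals have a box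
partition in which at most `e` directions are missing from each box. -/
theorem hasBoxPartition_of_isPrincipalFilter {κ : Type*} (s : Finset κ) {U : Set (Fin n →₀ ℕ)}
    (hU : IsPrincipalFilter U) {V : κ → Set (Fin n →₀ ℕ)} (hV : ∀ k, IsPrincipalFilter (V k)) :
    HasBoxPartition s.card {a | a ∈ U ∧ ∀ k ∈ s, a ∉ V k} := by
  classical
  induction s using Finset.induction_on with
  | empty =>
    rcases hU with rfl | ⟨γ, rfl⟩
    · simpa using HasBoxPartition.empty
    · rw [Finset.card_empty]
      convert HasBoxPartition.box (e := 0) γ Finset.univ (by simp) using 1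
      ext a
      simp [stanleyBox]
  | insert k s hk ih =>
    rw [Finset.card_insert_of_notMem hk]
    have hset : {a | a ∈ U ∧ ∀ k' ∈ insert k s, a ∉ V k'} =
        {a | a ∈ U ∧ ∀ k' ∈ s, a ∉ V k'} \ V k := by
      ext a
      simp only [Finset.forall_mem_insert, Set.mem_ofPred_eq, Set.mem_sdiff]
      tauto
    rw [hset]
    rcases hV k with hk | ⟨γ, hk⟩
    · rw [hk, Set.sdiff_empty]
      exact ih.succ
    · rw [hk]
      exact ih.diff_Ici γ

/-- Let `ℓ` be a bounded map from exponent vectors to `ℕ^κ` whose coordinates have principal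
filters as superlevel sets. A set that is cut out by a principal filter on each fiber of the
coordinates in `s` has a box partition with at most `|s|` directions missing from each box. -/
theorem hasBoxPartition_of_levels {κ : Type*} (s : Finset κ) {N : ℕ}
    {l : (Fin n →₀ ℕ) → κ → ℕ} (hN : ∀ a k, l a k ≤ N)
    (hl : ∀ t k, IsPrincipalFilter {a | t ≤ l a k}) {A : Set (Fin n →₀ ℕ)}
    (hA : ∀ c, ∃ W, IsPrincipalFilter W ∧ ∀ a, (∀ k ∈ s, l a k = l c k) → (a ∈ A ↔ a ∈ W)) :
    HasBoxPartition s.card A := by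
  classical
  refine HasBoxPartition.of_fibers (ι := s → Fin (N + 1))
    (fun a k => ⟨l a k, Nat.lt_succ_of_le (hN a k)⟩) fun p => ?_
  by_cases hp : ∃ c, (fun k : s => (⟨l c k, Nat.lt_succ_of_le (hN c k)⟩ : Fin (N + 1))) = p
  · obtain ⟨c, rfl⟩ := hp
    obtain ⟨W, hW, hAW⟩ := hA c
    convert hasBoxPartition_of_isPrincipalFilter s
      (hW.inter (IsPrincipalFilter.setOf_forall_mem s (fun k => hl (l c k) k)))
      (fun k => hl (l c k + 1) k) using 1
    ext a
    have hiff : ((fun k : s => (⟨l a k, Nat.lt_succ_of_le (hN a k)⟩ : Fin (N + 1))) =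
        fun k : s => ⟨l c k, Nat.lt_succ_of_le (hN c k)⟩) ↔ ∀ k ∈ s, l a k = l c k := by
      simp [funext_iff]
    simp only [Set.mem_ofPred_eq, Set.mem_inter_iff, hiff]
    constructor
    · rintro ⟨h1, h2⟩
      exact ⟨⟨(hAW a h2).1 h1, fun k hk => (h2 k hk).ge⟩, fun k hk => by rw [h2 k hk]; omega⟩
    · rintro ⟨⟨h1, h2⟩, h3⟩
      have h4 : ∀ k ∈ s, l a k = l c k := fun k hk => by
        have := h2 k hk
        have := h3 k hk
        omega
      exact ⟨(hAW a h4).2 h1, h4⟩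
  · convert HasBoxPartition.empty (n := n) (e := s.card) using 1
    ext a
    simp only [Set.mem_ofPred_eq, Set.mem_empty_iff_false, iff_false, not_and]
    exact fun _ h => hp ⟨a, h⟩

/-! ### Level functions attached to a separating labelling -/

/-- A labelling `j` of a set `G` of exponent vectors by points of `ℕ^d` is separating if, whenever
`c < g i` for some `g ∈ G`, some coordinate of the labels separates `g` from all `h ∈ G` with
`h i ≤ c`: the label of `g` in it is larger than theirs, and positive even if there are none. -/
def IsSeparating {d : ℕ} (G : Set (Fin n →₀ ℕ)) (j : (Fin n →₀ ℕ) → Fin d → ℕ) : Prop :=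
  ∀ g ∈ G, ∀ i, ∀ c < g i, ∃ k, 0 < j g k ∧ ∀ h ∈ G, j g k ≤ j h k → c < h i

/-- The exponent vectors above the coordinatewise minimum of `H`, that is, those of the monomials
divisible by the greatest common divisor of `H`, form a principal filter; for empty `H` no vector
qualifies, unless there are no variables at all. -/
theorem isPrincipalFilter_setOf_gcd (H : Set (Fin n →₀ ℕ)) :
    IsPrincipalFilter {a : Fin n →₀ ℕ | ∀ i, ∃ h ∈ H, h i ≤ a i} := by
  by_cases hH : ∀ _ : Fin n, H.Nonempty
  · refine Or.inr ⟨Finsupp.equivFunOnFinite.symm fun i => sInf ((fun h => h i) '' H), ?_⟩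
    ext a
    simp only [Set.mem_ofPred_eq, Set.mem_Ici, Finsupp.le_def,
      Finsupp.equivFunOnFinite_symm_apply_apply]
    refine forall_congr' fun i => ⟨?_, fun h => ?_⟩
    · rintro ⟨h, hh, hi⟩
      exact (Nat.sInf_le (Set.mem_image_of_mem (fun h => h i) hh)).trans hi
    · obtain ⟨g, hg, hgi⟩ := Nat.sInf_mem ((hH i).image fun h => h i)
      exact ⟨g, hg, le_of_eq_of_le hgi h⟩
  · push Not at hH
    obtain ⟨i, hi⟩ := hH
    refine Or.inl (Set.eq_empty_of_forall_notMem fun a ha => ?_)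
    obtain ⟨h, hh, _⟩ : ∃ h ∈ H, h i ≤ a i := ha i
    rw [hi] at hh
    exact hh

/-- A separating labelling extends to a level function on all exponent vectors: the `k`-th level
of `a` is the largest `t` such that `a` is divisible by the greatest common divisor of the elements
of `G` whose `k`-th label is at least `t`. -/
theorem IsSeparating.exists_levels {d : ℕ} {G : Set (Fin n →₀ ℕ)} (hG : G.Finite)
    {j : (Fin n →₀ ℕ) → Fin d → ℕ} (hj : IsSeparating G j) :
    ∃ (N : ℕ) (l : (Fin n →₀ ℕ) → Fin d → ℕ), (∀ a k, l a k ≤ N) ∧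
      (∀ t k, IsPrincipalFilter {a | t ≤ l a k}) ∧
      ∀ g ∈ G, ∀ a, g ≤ a ↔ j g ≤ l a := by
  classical
  let P : (Fin n →₀ ℕ) → Fin d → ℕ → Prop := fun a k t => ∀ i, ∃ h ∈ {h ∈ G | t ≤ j h k}, h i ≤ a i
  have hPanti : ∀ a k s t, s ≤ t → P a k t → P a k s := fun a k s t hst h i => by
    obtain ⟨g, ⟨hg, hgt⟩, hgi⟩ := h i
    exact ⟨g, ⟨hg, hst.trans hgt⟩, hgi⟩
  let N : ℕ := hG.toFinset.sup fun g => Finset.univ.sup (j g)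
  have hN : ∀ g ∈ G, ∀ k, j g k ≤ N := fun g hg k =>
    (Finset.le_sup (f := j g) (Finset.mem_univ k)).trans
      (Finset.le_sup (f := fun g => Finset.univ.sup (j g)) (hG.mem_toFinset.2 hg))
  let l : (Fin n →₀ ℕ) → Fin d → ℕ := fun a k => Nat.findGreatest (P a k) N
  have hl : ∀ a k t, t ≤ l a k ↔ t = 0 ∨ (t ≤ N ∧ P a k t) := fun a k t => by
    constructor
    · intro h
      refine or_iff_not_imp_left.2 fun ht => ⟨h.trans (Nat.findGreatest_le N), ?_⟩
      exact hPanti _ _ _ _ h (Nat.findGreatest_of_ne_zero (P := P a k) (n := N) rfl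
        fun h0 => ht (Nat.le_zero.1 (h0 ▸ h)))
    · rintro (rfl | ⟨h1, h2⟩)
      · exact Nat.zero_le _
      · exact Nat.le_findGreatest h1 h2
  -- separating coordinates have positive labels, so it does no harm that level `0` is attained by
  -- default
  refine ⟨N, l, fun a k => Nat.findGreatest_le N, fun t k => ?_, fun g hg a => ⟨?_, ?_⟩⟩
  · simp only [hl]
    by_cases h0 : t = 0
    · simpa [h0] using isPrincipalFilter_univ
    · by_cases htN : t ≤ N
      · simpa only [h0, htN, false_or, true_and] using isPrincipalFilter_setOf_gcd {h ∈ G | t ≤ j h k}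
      · exact Or.inl (by simp [h0, htN])
  · exact fun h k => (hl a k _).2 (Or.inr ⟨hN g hg k, fun i => ⟨g, ⟨hg, le_rfl⟩, h i⟩⟩)
  · intro h i
    by_contra! hi
    obtain ⟨k, hk0, hk⟩ := hj g hg i (a i) hi
    rcases (hl a k _).1 (h k) with h0 | ⟨_, hP⟩
    · omega
    · obtain ⟨g', ⟨hg', hjg'⟩, hgi⟩ := hP i
      exact absurd (hk g' hg' hjg') (not_lt.2 hgi)

/-- The box partition of the difference of the filters generated by `A` and `B`, subsets of a
finite set with a separating labelling in `ℕ^d`: each fiber of the level function lies either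
inside or outside of this difference. -/
theorem IsSeparating.hasBoxPartition_diff {d : ℕ} {G A B : Set (Fin n →₀ ℕ)} (hG : G.Finite)
    {j : (Fin n →₀ ℕ) → Fin d → ℕ} (hj : IsSeparating G j) (hA : A ⊆ G) (hB : B ⊆ G) :
    HasBoxPartition d {a | (∃ g ∈ A, g ≤ a) ∧ ¬ ∃ g ∈ B, g ≤ a} := by
  obtain ⟨N, l, hN, hl, hgl⟩ := hj.exists_levels hG
  convert hasBoxPartition_of_levels Finset.univ hN hl fun c => ?_ using 1
  · simp
  have hfib : ∀ a, (∀ k ∈ Finset.univ, l a k = l c k) → ∀ C ⊆ G,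
      ((∃ g ∈ C, g ≤ a) ↔ ∃ g ∈ C, g ≤ c) := fun a ha C hC => by
    have hac : l a = l c := funext fun k => ha k (Finset.mem_univ k)
    exact exists_congr fun g => and_congr_right fun hg => by
      rw [hgl g (hC hg) a, hgl g (hC hg) c, hac]
  by_cases hc : (∃ g ∈ A, g ≤ c) ∧ ¬ ∃ g ∈ B, g ≤ c
  · refine ⟨Set.univ, isPrincipalFilter_univ, fun a ha => ?_⟩
    simpa only [Set.mem_ofPred_eq, hfib a ha A hA, hfib a ha B hB, Set.mem_univ, iff_true] using hc
  · refine ⟨∅, Or.inl rfl, fun a ha => ?_⟩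
    simpa only [Set.mem_ofPred_eq, hfib a ha A hA, hfib a ha B hB, Set.mem_empty_iff_false,
      iff_false] using hc

/-- For the filter generated by `A` alone one coordinate can be left free: when all levels but
the one for the coordinate `0` are fixed, the filter is a condition of the form `t ≤ l a 0`, hence
a principal filter or empty. -/
theorem IsSeparating.hasBoxPartition_filter {d : ℕ} {G A : Set (Fin n →₀ ℕ)} (hG : G.Finite)
    {j : (Fin n →₀ ℕ) → Fin (d + 1) → ℕ} (hj : IsSeparating G j) (hA : A ⊆ G) :
    HasBoxPartition d {a | ∃ g ∈ A, g ≤ a} := by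
  obtain ⟨N, l, hN, hl, hgl⟩ := hj.exists_levels hG
  convert hasBoxPartition_of_levels (Finset.univ.erase (0 : Fin (d + 1))) hN hl fun c => ?_ using 1
  · simp
  let T : Set ℕ := {t | ∃ g ∈ A, (∀ k ≠ 0, j g k ≤ l c k) ∧ j g 0 = t}
  have hmem : ∀ a, (∀ k ∈ Finset.univ.erase (0 : Fin (d + 1)), l a k = l c k) →
      ((∃ g ∈ A, g ≤ a) ↔ ∃ t ∈ T, t ≤ l a 0) := fun a ha => by
    have ha' : ∀ k ≠ 0, l a k = l c k := fun k hk => ha k (by simp [hk])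
    constructor
    · rintro ⟨g, hg, hga⟩
      have := (hgl g (hA hg) a).1 hga
      exact ⟨_, ⟨g, hg, fun k hk => ha' k hk ▸ this k, rfl⟩, this 0⟩
    · rintro ⟨_, ⟨g, hg, h1, rfl⟩, h0⟩
      refine ⟨g, hg, (hgl g (hA hg) a).2 fun k => ?_⟩
      by_cases hk : k = 0
      · exact hk ▸ h0
      · exact ha' k hk ▸ h1 k hk
  by_cases hT : T.Nonempty
  · refine ⟨_, hl (sInf T) 0, fun a ha => (hmem a ha).trans ⟨?_, fun h => ⟨_, Nat.sInf_mem hT, h⟩⟩⟩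
    rintro ⟨t, ht, hta⟩
    exact (Nat.sInf_le ht).trans hta
  · refine ⟨∅, Or.inl rfl, fun a ha => (hmem a ha).trans ?_⟩
    simp [Set.not_nonempty_iff_eq_empty.1 hT]

end Combinatorics

/-! ### From box partitions to Stanley decompositions -/

section Algebra

variable {K : Type*} [Field K] {n : ℕ}

open MvPolynomial

theorem IsMonomialIdeal.mem_iff {I : Ideal (MvPolynomial (Fin n) K)} (hI : IsMonomialIdeal I)
    {f : MvPolynomial (Fin n) K} : f ∈ I ↔ ∀ a ∈ f.support, monomial a (1 : K) ∈ I := by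
  obtain ⟨A, rfl⟩ := hI
  simp only [mem_ideal_span_monomial_image]
  refine forall₂_congr fun a _ => ?_
  simp

theorem isMonomialIdeal_bot : IsMonomialIdeal (⊥ : Ideal (MvPolynomial (Fin n) K)) :=
  ⟨∅, by simp⟩

theorem monomial_mem_of_le {I : Ideal (MvPolynomial (Fin n) K)} {a b : Fin n →₀ ℕ} (hab : a ≤ b)
    (c : K) (ha : monomial a (1 : K) ∈ I) : monomial b c ∈ I := by
  have h := I.mul_mem_left (monomial (b - a) c) ha
  rwa [monomial_mul, mul_one, tsub_add_cancel_of_le hab] at h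

theorem mem_stanleyBox_of_mem_support {u : Fin n →₀ ℕ} {Z : Finset (Fin n)}
    {v : MvPolynomial (Fin n) K} (hv : v ∈ supported K (Z : Set (Fin n))) {a : Fin n →₀ ℕ}
    (ha : a ∈ (v * monomial u (1 : K)).support) : a ∈ stanleyBox u Z := by
  rw [mem_support_iff, coeff_mul_monomial'] at ha
  split_ifs at ha with hua
  · refine ⟨hua, fun i hi => ?_⟩
    by_contra hne
    have hvars : i ∈ v.vars :=
      (mem_vars_iff_mem_support i).2 ⟨a - u, mem_support_iff.2 (by simpa using ha), by
        have := hua i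
        simp only [Finsupp.mem_support_iff, Finsupp.tsub_apply]
        omega⟩
    exact hi (mem_supported.1 hv hvars)
  · exact (ha rfl).elim

theorem monomial_mem_supported {a : Fin n →₀ ℕ} {Z : Finset (Fin n)} (c : K)
    (h : ∀ i ∉ Z, a i = 0) : monomial a c ∈ supported K (Z : Set (Fin n)) := by
  rw [mem_supported]
  intro i hi
  obtain ⟨b, hb, hbi⟩ := (mem_vars_iff_mem_support i).1 hi
  have hba : b = a := by simpa using support_monomial_subset hb
  by_contra hiZ
  exact Finsupp.mem_support_iff.1 hbi (hba ▸ h i hiZ)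

variable {M : Type*} [AddCommGroup M] [Module (MvPolynomial (Fin n) K) M] [Module K M]
  [IsScalarTower K (MvPolynomial (Fin n) K) M] {I J : Ideal (MvPolynomial (Fin n) K)}

/-- Let `M` be a graded quotient of the monomial ideal `I`, with kernel the monomial ideal `J`.
A box partition of the set of exponent vectors of the monomials in `I` outside of `J` gives a
Stanley decomposition of `M`. -/
theorem exists_stanleyDecomposition (hI : IsMonomialIdeal I) (hJ : IsMonomialIdeal J)
    {gr : (Fin n → ℤ) → Submodule K M} (π : I →ₗ[MvPolynomial (Fin n) K] M)
    (hsurj : Function.Surjective π)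
    (hker : ∀ f : I, π f = 0 ↔ (f : MvPolynomial (Fin n) K) ∈ J)
    (hgr : ∀ a, ∀ f ∈ idealComponent I a, π f ∈ gr a) {m : ℕ} {u : Fin m → Fin n →₀ ℕ}
    {Z : Fin m → Finset (Fin n)}
    (hsub : ∀ i, stanleyBox (u i) (Z i) ⊆ {a | monomial a (1 : K) ∈ I ∧ monomial a (1 : K) ∉ J})
    (hcover : ∀ a ∈ {a | monomial a (1 : K) ∈ I ∧ monomial a (1 : K) ∉ J},
      ∃ i, a ∈ stanleyBox (u i) (Z i))
    (hdisj : ∀ a i k, a ∈ stanleyBox (u i) (Z i) → a ∈ stanleyBox (u k) (Z k) → i = k) :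
    ∃ D : StanleyDecomposition gr, Set.range (fun i => (D.Z i).card) =
      Set.range fun i => (Z i).card := by
  let x : Fin m → I := fun i => ⟨monomial (u i) 1, (hsub i (self_mem_stanleyBox _ _)).1⟩
  have hspace : ∀ i y, y ∈ stanleySpace (K := K) (π (x i)) (Z i) ↔
      ∃ v ∈ supported K (Z i : Set (Fin n)), v • π (x i) = y := fun i y => by
    simp [stanleySpace, Submodule.mem_map]
  refine ⟨⟨m, fun i => π (x i), Z, fun i => ⟨fun k => u i k, hgr _ _ ?_⟩, ?_, ?_⟩, rfl⟩
  · intro b hb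
    have hbu : b = u i := by simpa using support_monomial_subset hb
    rw [hbu]
  · intro i v hv h0
    rw [← map_smul, hker] at h0
    by_contra hv0
    have hne : v * monomial (u i) (1 : K) ≠ 0 :=
      mul_ne_zero hv0 (by simp)
    obtain ⟨a, ha⟩ := support_nonempty.2 hne
    exact (hsub i (mem_stanleyBox_of_mem_support hv ha)).2 (hJ.mem_iff.1 h0 a ha)
  · refine DirectSum.isInternal_submodule_of_iSupIndep_of_iSup_eq_top ?_ ?_
    · rw [iSupIndep_iff_finsetSum_eq_zero_imp_eq_zero]
      intro s y hy hsum i hi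
      choose! v hv hvy using fun i hi => (hspace i (y i)).1 (hy i hi)
      have hmem : ∑ i ∈ s, v i * monomial (u i) (1 : K) ∈ J := by
        have h : π (∑ i ∈ s, v i • x i) = 0 := by
          rw [map_sum, ← hsum]
          exact Finset.sum_congr rfl fun i hi => by rw [map_smul, hvy i hi]
        rw [hker] at h
        simpa [x] using h
      rw [← hvy i hi, ← map_smul, hker]
      refine hJ.mem_iff.2 fun a ha => hJ.mem_iff.1 hmem a ?_
      have hai : a ∈ stanleyBox (u i) (Z i) := mem_stanleyBox_of_mem_support (hv i hi) ha
      -- the boxes are disjoint, so that the `i`-th summand alone contributes to this coefficient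
      have hcoeff : coeff a (∑ k ∈ s, v k * monomial (u k) (1 : K)) =
          coeff a (v i * monomial (u i) (1 : K)) := by
        rw [coeff_sum]
        refine Finset.sum_eq_single_of_mem i hi fun k hk hki => ?_
        by_contra hne
        exact hki (hdisj a k i (mem_stanleyBox_of_mem_support (hv k hk) (mem_support_iff.2 hne)) hai)
      rw [mem_support_iff, hcoeff]
      exact mem_support_iff.1 ha
    · rw [eq_top_iff]
      rintro y -
      obtain ⟨⟨f, hf⟩, rfl⟩ := hsurj y
      have hterm : ∀ a ∈ f.support, monomial a (coeff a f) ∈ I := fun a ha =>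
        monomial_mem_of_le le_rfl _ (hI.mem_iff.1 hf a ha)
      have hsum : (⟨f, hf⟩ : I) = ∑ a ∈ f.support.attach, ⟨_, hterm a.1 a.2⟩ := by
        apply Subtype.ext
        rw [AddSubmonoidClass.coe_finsetSum]
        exact f.as_sum.trans (Finset.sum_attach _ fun a => monomial a (coeff a f)).symm
      rw [hsum, map_sum]
      refine Submodule.sum_mem _ fun a _ => ?_
      by_cases haJ : monomial a.1 (1 : K) ∈ J
      · rw [(hker _).2 (monomial_mem_of_le le_rfl _ haJ)]
        exact Submodule.zero_mem _
      · obtain ⟨i, hi⟩ := hcover a.1 ⟨hI.mem_iff.1 hf a.1 a.2, haJ⟩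
        refine Submodule.mem_iSup_of_mem i ((hspace i _).2
          ⟨monomial (a.1 - u i) (coeff a.1 f), monomial_mem_supported _ fun k hk => ?_, ?_⟩)
        · rw [Finsupp.tsub_apply, hi.2 k hk, Nat.sub_self]
        · rw [← map_smul]
          congr 1
          apply Subtype.ext
          simp [x, monomial_mul, tsub_add_cancel_of_le hi.1]

theorem StanleyDecomposition.sdepth_le {gr : (Fin n → ℤ) → Submodule K M}
    (D : StanleyDecomposition gr) : D.sdepth ≤ n := by
  rcases (Set.range fun i => (D.Z i).card).eq_empty_or_nonempty with h | ⟨_, i, rfl⟩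
  · simp [StanleyDecomposition.sdepth, h]
  · exact (Nat.sInf_le (Set.mem_range_self i)).trans (card_finset_fin_le _)

/-- A box partition of the set of exponent vectors of the monomials in `I` outside of `J` bounds
the Stanley depth of `I / J` from below. -/
theorem HasBoxPartition.le_sdepth (hI : IsMonomialIdeal I) (hJ : IsMonomialIdeal J) (hJI : J < I)
    {gr : (Fin n → ℤ) → Submodule K M} (π : I →ₗ[MvPolynomial (Fin n) K] M)
    (hsurj : Function.Surjective π)
    (hker : ∀ f : I, π f = 0 ↔ (f : MvPolynomial (Fin n) K) ∈ J)
    (hgr : ∀ a, ∀ f ∈ idealComponent I a, π f ∈ gr a) {e : ℕ}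
    (h : HasBoxPartition e {a | monomial a (1 : K) ∈ I ∧ monomial a (1 : K) ∉ J}) :
    n ≤ sdepth gr + e := by
  obtain ⟨m, u, Z, hcard, hsub, hcover, hdisj⟩ := h.exists_family
  obtain ⟨D, hD⟩ := exists_stanleyDecomposition hI hJ π hsurj hker hgr hsub hcover hdisj
  -- a monomial of `I` outside of `J` shows that there is at least one box, so that the minimum in
  -- the Stanley depth is not taken over the empty set
  obtain ⟨f, hfI, hfJ⟩ := SetLike.exists_of_lt hJI
  have hne : ∃ a, monomial a (1 : K) ∈ I ∧ monomial a (1 : K) ∉ J := by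
    rw [hJ.mem_iff] at hfJ
    push Not at hfJ
    obtain ⟨a, ha, haJ⟩ := hfJ
    exact ⟨a, hI.mem_iff.1 hfI a ha, haJ⟩
  obtain ⟨a, ha⟩ := hne
  obtain ⟨i, -⟩ := hcover a ha
  have hDle : n ≤ D.sdepth + e := by
    have hmem : D.sdepth ∈ Set.range fun i => (D.Z i).card :=
      Nat.sInf_mem (hD ▸ ⟨_, i, rfl⟩)
    rw [hD] at hmem
    obtain ⟨k, hk⟩ := hmem
    exact hk ▸ hcard k
  have hle : D.sdepth ≤ sdepth gr :=
    le_csSup ⟨n, by rintro _ ⟨D', rfl⟩; exact D'.sdepth_le⟩ ⟨D, rfl⟩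
  omega

end Algebra

/-! ### The lcm lattice and its order dimension -/

section LcmLattice

variable {K : Type*} [Field K] {n : ℕ}

open MvPolynomial

theorem finite_minGens (I : Ideal (MvPolynomial (Fin n) K)) : (minGens I).Finite :=
  WellQuasiOrderedLE.finite_of_isAntichain (setOfPred_minimal_antichain _)

theorem monomial_mem_iff_exists_minGens {I : Ideal (MvPolynomial (Fin n) K)} {a : Fin n →₀ ℕ} :
    monomial a (1 : K) ∈ I ↔ ∃ g ∈ minGens I, g ≤ a := by
  constructor
  · intro h
    obtain ⟨g, hga, hg⟩ := exists_minimal_le_of_wellFoundedLT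
      (fun b => monomial b (1 : K) ∈ I) a h
    exact ⟨g, hg, hga⟩
  · rintro ⟨g, hg, hga⟩
    exact monomial_mem_of_le hga _ (show Minimal (fun b => monomial b (1 : K) ∈ I) g from hg).prop

/-- The infimum defining the order dimension of the lcm lattice is attained: the lcm lattice embeds
into `ℕ^(n+1)`, the last coordinate separating the additional minimal element from the monomial
`1`. -/
theorem nonempty_orderEmbedding_orderDim (I J : Ideal (MvPolynomial (Fin n) K)) :
    Nonempty (LcmLattice I J ↪o (Fin (orderDim (LcmLattice I J)) → ℕ)) := by
  suffices h : {d | Nonempty (LcmLattice I J ↪o (Fin d → ℕ))}.Nonempty from Nat.sInf_mem h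
  let f : LcmLattice I J → Fin (n + 1) → ℕ :=
    WithBot.recBotCoe 0 fun m => Fin.snoc (α := fun _ => ℕ) m.1 1
  refine ⟨n + 1, ⟨OrderEmbedding.ofMapLEIff f fun p q => ?_⟩⟩
  induction p using WithBot.recBotCoe with
  | bot => simp [f]
  | coe p =>
    induction q using WithBot.recBotCoe with
    | bot =>
      simp only [WithBot.not_coe_le_bot, iff_false]
      intro h
      simpa [f] using h (Fin.last n)
    | coe q =>
      simp only [f, WithBot.recBotCoe_coe, WithBot.coe_le_coe, Pi.le_def, Fin.forall_fin_succ',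
        Fin.snoc_castSucc, Fin.snoc_last, le_refl, and_true]
      rfl

theorem mem_lcmSet_of_mem {I J : Ideal (MvPolynomial (Fin n) K)} {g : Fin n →₀ ℕ}
    (hg : g ∈ minGens I ∪ minGens J) : g ∈ lcmSet I J :=
  ⟨{g}, by simp, by simpa using hg, by simp⟩

/-- An order embedding of the lcm lattice into `ℕ^d` restricts to a separating labelling of the
generators: the generators `h` with `h i ≤ c` have a least upper bound `r` in the lcm lattice with
`r i ≤ c`, so that `g ≰ r`, and a coordinate in which the label of `g` exceeds that of `r`
separates. -/
theorem exists_isSeparating {I J : Ideal (MvPolynomial (Fin n) K)} {d : ℕ}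
    (φ : LcmLattice I J ↪o (Fin d → ℕ)) :
    ∃ j : (Fin n →₀ ℕ) → Fin d → ℕ, IsSeparating (minGens I ∪ minGens J) j := by
  classical
  let ι : (Fin n →₀ ℕ) → LcmLattice I J := fun g =>
    if hg : g ∈ lcmSet I J then ((⟨g, hg⟩ : lcmSet I J) : LcmLattice I J) else ⊥
  have hι : ∀ g (hg : g ∈ minGens I ∪ minGens J),
      ι g = ((⟨g, mem_lcmSet_of_mem hg⟩ : lcmSet I J) : LcmLattice I J) :=
    fun g hg => dif_pos (mem_lcmSet_of_mem hg)
  refine ⟨fun g => φ (ι g), fun g hg i c hc => ?_⟩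
  obtain ⟨r, hr, hgr⟩ : ∃ r : LcmLattice I J,
      (∀ h ∈ minGens I ∪ minGens J, h i ≤ c → ι h ≤ r) ∧ ¬ ι g ≤ r := by
    let T : Finset (Fin n →₀ ℕ) :=
      ((finite_minGens I).union (finite_minGens J)).toFinset.filter fun h => h i ≤ c
    have hT : ∀ h, h ∈ T ↔ h ∈ minGens I ∪ minGens J ∧ h i ≤ c := fun h => by simp [T]
    by_cases hTne : T.Nonempty
    · have hTmem : T.sup id ∈ lcmSet I J := ⟨T, hTne, fun h hh => ((hT h).1 hh).1, rfl⟩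
      refine ⟨((⟨T.sup id, hTmem⟩ : lcmSet I J) : LcmLattice I J), fun h hh hc' => ?_, ?_⟩
      · rw [hι h hh, WithBot.coe_le_coe]
        exact Finset.le_sup (f := id) ((hT h).2 ⟨hh, hc'⟩)
      · rw [hι g hg, WithBot.coe_le_coe]
        intro hle
        have hsup : (T.sup id) i ≤ c :=
          Finset.sup_induction (p := fun a : Fin n →₀ ℕ => a i ≤ c) (Nat.zero_le c)
            (fun a ha b hb => by simpa using ⟨ha, hb⟩) fun h hh => ((hT h).1 hh).2
        have hgi : g i ≤ (T.sup id) i := (show g ≤ T.sup id from hle) i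
        omega
    · refine ⟨⊥, fun h hh hc' => (hTne ⟨h, (hT h).2 ⟨hh, hc'⟩⟩).elim, ?_⟩
      rw [hι g hg]
      exact WithBot.not_coe_le_bot _
  rw [← φ.le_iff_le, Pi.le_def] at hgr
  push Not at hgr
  obtain ⟨k, hk⟩ := hgr
  refine ⟨k, (Nat.zero_le _).trans_lt hk, fun h hh hgh => ?_⟩
  by_contra! hhi
  exact absurd (φ.le_iff_le.2 (hr h hh hhi) k) (not_le.2 (hk.trans_le hgh))

theorem orderDim_lcmLattice_ne_zero {I J : Ideal (MvPolynomial (Fin n) K)}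
    (hI : (minGens I).Nonempty) : orderDim (LcmLattice I J) ≠ 0 := by
  intro h0
  obtain ⟨φ⟩ := nonempty_orderEmbedding_orderDim I J
  obtain ⟨g, hg⟩ := hI
  have hlt := φ.lt_iff_lt.2 (WithBot.bot_lt_coe (⟨g, mem_lcmSet_of_mem (Or.inl hg)⟩ : lcmSet I J))
  have : IsEmpty (Fin (orderDim (LcmLattice I J))) := h0 ▸ Fin.isEmpty
  exact hlt.ne (Subsingleton.elim _ _)

theorem le_sdepthQuotient_add_orderDim {I J : Ideal (MvPolynomial (Fin n) K)}
    (hI : IsMonomialIdeal I) (hJ : IsMonomialIdeal J) (hJI : J < I) :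
    n ≤ sdepthQuotient I J + orderDim (LcmLattice I J) := by
  obtain ⟨φ⟩ := nonempty_orderEmbedding_orderDim I J
  obtain ⟨j, hj⟩ := exists_isSeparating φ
  refine HasBoxPartition.le_sdepth hI hJ hJI (Submodule.mkQ (Submodule.submoduleOf J I))
    (Submodule.mkQ_surjective _) (fun f => ?_)
    (fun a f hf => Submodule.mem_map_of_mem hf) ?_
  · rw [Submodule.mkQ_apply, Submodule.Quotient.mk_eq_zero]
    rfl
  · simp only [monomial_mem_iff_exists_minGens]
    exact hj.hasBoxPartition_diff ((finite_minGens I).union (finite_minGens J))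
      Set.subset_union_left Set.subset_union_right

theorem succ_le_sdepthIdeal_add_orderDim {I : Ideal (MvPolynomial (Fin n) K)}
    (hI : IsMonomialIdeal I) (hI0 : ⊥ < I) :
    n + 1 ≤ sdepthIdeal I + orderDim (LcmLattice I ⊥) := by
  have hne : (minGens I).Nonempty := by
    obtain ⟨f, hf, hf0⟩ := SetLike.exists_of_lt hI0
    obtain ⟨a, ha⟩ := support_nonempty.2 (by simpa using hf0 : f ≠ 0)
    obtain ⟨g, hg, -⟩ := monomial_mem_iff_exists_minGens.1 (hI.mem_iff.1 hf a ha)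
    exact ⟨g, hg⟩
  obtain ⟨φ⟩ := nonempty_orderEmbedding_orderDim I ⊥
  obtain ⟨d, hd⟩ := Nat.exists_eq_succ_of_ne_zero (orderDim_lcmLattice_ne_zero (J := ⊥) hne)
  rw [hd] at φ ⊢
  obtain ⟨j, hj⟩ := exists_isSeparating φ
  have h : n ≤ sdepthIdeal I + d := by
    refine HasBoxPartition.le_sdepth hI isMonomialIdeal_bot hI0 LinearMap.id
      Function.surjective_id (fun f => by simp) (fun a f hf => hf) ?_
    have hset : {a | monomial a (1 : K) ∈ I ∧
        monomial a (1 : K) ∉ (⊥ : Ideal (MvPolynomial (Fin n) K))} =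
        {a | ∃ g ∈ minGens I, g ≤ a} := by
      simp [monomial_mem_iff_exists_minGens]
    rw [hset]
    exact hj.hasBoxPartition_filter ((finite_minGens I).union (finite_minGens ⊥))
      Set.subset_union_left
  omega

end LcmLattice

end StanleyDim

theorem mainTheorem3 {K : Type*} [Field K] {n : ℕ} (I J : Ideal (MvPolynomial (Fin n) K))
    (hI : StanleyDim.IsMonomialIdeal I) (hJ : StanleyDim.IsMonomialIdeal J) (hJI : J < I) :
    (n : ℤ) - StanleyDim.orderDim (StanleyDim.LcmLattice I J) ≤ StanleyDim.sdepthQuotient I J ∧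
    (n : ℤ) - StanleyDim.orderDim (StanleyDim.LcmLattice I ⊥) + 1 ≤ StanleyDim.sdepthIdeal I := by
  have h1 := StanleyDim.le_sdepthQuotient_add_orderDim hI hJ hJI
  have h2 := StanleyDim.succ_le_sdepthIdeal_add_orderDim hI (bot_le.trans_lt hJI)
  omega
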